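/- All graphs are finite, simple and have at least one vertex. The $0$-sum of two disjoint graphs is their disjoint union; their join is obtained from the $0$-sum by adding all edges between the two graphs; a $1$-sum of two disjoint graphs is obtained by identifying a vertex of one with a vertex of the other. A graph is a sesquicograph if it can be generated (up to isomorphism) from the single-vertex graph $K_1$ using joins, $0$-sums and $1$-sums. Let $\overline{P_5}$ be the complement of the path on five vertices. Let $C_6$ be the $6$-cycle with vertices $0,1,2,3,4,5$ in cyclic order, and let the following graphs be obtained from $C_6$ by adding the listed chords: the domino $C_6^+$: $14$; $H_1$: $14,24,25,15$; $H_2$: $14,24,25$; $H_3$: $14,25$; $H_4$: $15,14,24$; $H_5$: $15,35,13$. Theorem. A graph $G$ is a sesquicograph if and only if no induced subgraph of $G$ is isomorphic to a cycle of length at least five or to one of $\overline{P_5}, C_6^+, H_1, H_2, H_3, H_4, H_5$. Moreover, up to isomorphism, these graphs (the cycles of length at least five, $\overline{P_5}$, $C_6^+$, $H_1,\dots,H_5$) are exactly the induced-subgraph-minimal non-sesquicographs, that is, the graphs that are not sesquicographs but all of whose proper induced subgraphs are sesquicographs. -/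

import Mathlib

open SimpleGraph

universe u

/-- The join of `G` and `H`: their disjoint union together with all edges joining a vertex of `G`
to a vertex of `H`. -/
def graphJoin {V W : Type*} (G : SimpleGraph V) (H : SimpleGraph W) : SimpleGraph (V ⊕ W) :=
  (G ⊕g H) ⊔ completeBipartiteGraph V W

/-- Adjacency in the `1`-sum obtained by identifying the vertex `a` of `G` with the vertex `b` of
`H`. The identified vertex is represented by `a`. -/
def oneSumAdj {V W : Type*} (G : SimpleGraph V) (a : V) (H : SimpleGraph W) (b : W) :
    V ⊕ {w : W // w ≠ b} → V ⊕ {w : W // w ≠ b} → Prop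
  | Sum.inl v, Sum.inl v' => G.Adj v v'
  | Sum.inr w, Sum.inr w' => H.Adj w.1 w'.1
  | Sum.inl v, Sum.inr w => v = a ∧ H.Adj b w.1
  | Sum.inr w, Sum.inl v => v = a ∧ H.Adj b w.1

/-- The `1`-sum of `G` and `H` obtained by identifying the vertex `a` of `G` with the vertex `b`
of `H`. -/
def oneSum {V W : Type*} (G : SimpleGraph V) (a : V) (H : SimpleGraph W) (b : W) :
    SimpleGraph (V ⊕ {w : W // w ≠ b}) where
  Adj := oneSumAdj G a H b
  symm := ⟨by
    rintro (v | w) (v' | w') h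
    · exact G.adj_symm h
    · exact h
    · exact h
    · exact H.adj_symm h⟩
  loopless := ⟨by
    rintro (v | w) h
    · exact G.irrefl h
    · exact H.irrefl h⟩

/-- Sesquicographs: the graphs that can be generated, up to isomorphism, from the single-vertex
graph `K₁` using joins, `0`-sums (disjoint unions) and `1`-sums. -/
inductive IsSesquicograph : {V : Type u} → SimpleGraph V → Prop
  | single : IsSesquicograph (⊥ : SimpleGraph PUnit.{u + 1})
  | iso {V W : Type u} {G : SimpleGraph V} {H : SimpleGraph W} (e : G ≃g H) :
      IsSesquicograph G → IsSesquicograph H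
  | join {V W : Type u} {G : SimpleGraph V} {H : SimpleGraph W} :
      IsSesquicograph G → IsSesquicograph H → IsSesquicograph (graphJoin G H)
  | zeroSum {V W : Type u} {G : SimpleGraph V} {H : SimpleGraph W} :
      IsSesquicograph G → IsSesquicograph H → IsSesquicograph (G ⊕g H)
  | oneSum {V W : Type u} {G : SimpleGraph V} {H : SimpleGraph W} (a : V) (b : W) :
      IsSesquicograph G → IsSesquicograph H → IsSesquicograph (oneSum G a H b)

/-- An induced-subgraph-minimal non-sesquicograph: it is not a sesquicograph, but each of its
proper (nonempty) induced subgraphs is one. -/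
def IsMinimalNonSesquicograph {V : Type u} (G : SimpleGraph V) : Prop :=
  ¬ IsSesquicograph G ∧
    ∀ s : Set V, s.Nonempty → s ≠ Set.univ → IsSesquicograph (G.induce s)

/-- The complement of the path `P₅` on five vertices. -/
def coP5 : SimpleGraph (Fin 5) := (pathGraph 5)ᶜ

/-- The domino `C₆⁺`: the `6`-cycle `0 1 2 3 4 5` with a chord that creates two `4`-cycles. -/
def domino : SimpleGraph (Fin 6) := cycleGraph 6 ⊔ fromEdgeSet {s(1, 4)}

/-- `H₁`: the `6`-cycle `0 1 2 3 4 5` with the four chords `14`, `24`, `25`, `15`. -/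
def graphH1 : SimpleGraph (Fin 6) :=
  cycleGraph 6 ⊔ fromEdgeSet {s(1, 4), s(2, 4), s(2, 5), s(1, 5)}

/-- `H₂`: the `6`-cycle `0 1 2 3 4 5` with the three chords `14`, `24`, `25`. -/
def graphH2 : SimpleGraph (Fin 6) :=
  cycleGraph 6 ⊔ fromEdgeSet {s(1, 4), s(2, 4), s(2, 5)}

/-- `H₃`: the `6`-cycle `0 1 2 3 4 5` with the two chords `14`, `25`. -/
def graphH3 : SimpleGraph (Fin 6) :=
  cycleGraph 6 ⊔ fromEdgeSet {s(1, 4), s(2, 5)}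

/-- `H₄`: the `6`-cycle `0 1 2 3 4 5` with the three chords `15`, `14`, `24`. -/
def graphH4 : SimpleGraph (Fin 6) :=
  cycleGraph 6 ⊔ fromEdgeSet {s(1, 5), s(1, 4), s(2, 4)}

/-- `H₅`: the `6`-cycle `0 1 2 3 4 5` with the three chords `15`, `35`, `13`. -/
def graphH5 : SimpleGraph (Fin 6) :=
  cycleGraph 6 ⊔ fromEdgeSet {s(1, 5), s(3, 5), s(1, 3)}

/-!
Call a graph *indecomposable* if it has at least two vertices, it and its complement are connected,
and no vertex separates it. An induced subgraph of a `0`-sum, join or `1`-sum that is indecomposable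
lies in one of the two parts, so a sesquicograph has no indecomposable induced subgraph
(`IsSesquicograph.not_isIndContained`). The listed graphs are indecomposable, hence are not induced
subgraphs of sesquicographs. Conversely, a graph with at least two vertices that is not
indecomposable is a `0`-sum, join or `1`-sum of smaller induced subgraphs. It therefore remains to
show that a finite indecomposable graph `G` contains a listed graph
(`IsIndecomposable.not_isObstructionFree`). Suppose it contains none.

*Diameter at least three* (`IsObstructionFree.farFrom_eq_empty`). If `x` and `y` have distance at
least three and `X` is the component of `x` among the vertices at distance at least three from `y`,
then `X` has two neighbours `w₁`, `w₂`, as `G` has no cut vertex. Using only long cycles, the house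
and the domino, any two such neighbours have a common neighbour `x₁` in `X`. So there are two paths
of length three from `x₁` to `y`, through `w₁` and `w₂`. If these can be chosen disjoint, the six
vertices span a hexagon with at most four undetermined chords, and each of the sixteen cases contains
a listed graph (`IsObstructionFree.not_two_paths`). Otherwise `w₁` and `w₂` have a common neighbour
adjacent to `y`, and the same argument started from `x₁` instead of `y` gives disjoint paths.

*Diameter at most two* (`IsObstructionFree.false_of_diam_two`). Take a maximal set `S` that induces
a connected subgraph of the complement and has a vertex `e` complete to it. Some vertex `f` outside
`S` is adjacent to a part `T` of `S`, but not to `U = S \ T`, nor to `e`. Excluding the house and the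
`3`-sun `H₅` makes the neighbourhoods in `U` of the vertices of `T` nested, and equal for nonadjacent
ones; with diameter two, a largest of them is all of `U`. The vertices of `T` complete to `U` are then
complete to the rest of `S`, against the choice of `S`.

Minimality amounts to the fact that no listed graph is a proper induced subgraph of another
(`IsObstruction.surjective`).
-/

/-! ### Connectedness by cuts and indecomposable graphs -/

/-- A set `S` of vertices is *cut-connected* in `G` if every partition of `S` into two nonempty
parts is crossed by an edge, that is, if `S` is empty or induces a connected subgraph. Only this
formulation by cuts is ever used. -/
def CutConnected {V : Type*} (G : SimpleGraph V) (S : Set V) : Prop :=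
  ∀ A ⊆ S, A.Nonempty → (S \ A).Nonempty → ∃ a ∈ A, ∃ b ∈ S \ A, G.Adj a b

section CutConnected

variable {V : Type*} {G : SimpleGraph V} {S : Set V}

lemma CutConnected.singleton (G : SimpleGraph V) (x : V) : CutConnected G {x} := by
  rintro A hA ⟨a, ha⟩ ⟨b, hb, hbA⟩
  obtain rfl : a = x := hA ha
  obtain rfl : b = a := hb
  exact absurd ha hbA

lemma CutConnected.insert (hS : CutConnected G S) {f s : V} (hs : s ∈ S)
    (h : G.Adj s f) : CutConnected G (insert f S) := by
  intro A hA hne hne'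
  by_cases h1 : (A ∩ S).Nonempty
  · by_cases h2 : (S \ A).Nonempty
    · obtain ⟨a, ha, b, hb, hab⟩ := hS (A ∩ S) Set.inter_subset_right h1
        (by obtain ⟨z, hz⟩ := h2; exact ⟨z, hz.1, fun h => hz.2 h.1⟩)
      exact ⟨a, ha.1, b, ⟨Or.inr hb.1, fun h => hb.2 ⟨h, hb.1⟩⟩, hab⟩
    · have hSA : S ⊆ A := by
        intro z hz
        by_contra hzA
        exact h2 ⟨z, hz, hzA⟩
      obtain ⟨z, hz, hzA⟩ := hne'
      rcases hz with rfl | hz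
      · exact ⟨s, hSA hs, z, ⟨Or.inl rfl, hzA⟩, h⟩
      · exact absurd (hSA hz) hzA
  · obtain ⟨a, ha⟩ := hne
    have haf : a = f := by
      rcases hA ha with h | h
      · exact h
      · exact absurd ⟨a, ha, h⟩ h1
    subst haf
    exact ⟨a, ha, s, ⟨Or.inr hs, fun h => h1 ⟨s, h, hs⟩⟩, h.symm⟩

lemma CutConnected.of_forall_common
    (h : ∀ a b, a ≠ b → G.Adj a b ∨ ∃ c, G.Adj a c ∧ G.Adj c b) :
    CutConnected G (Set.univ : Set V) := by
  rintro A - ⟨a, ha⟩ ⟨b, -, hb⟩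
  rcases h a b (by rintro rfl; exact hb ha) with h | ⟨c, h1, h2⟩
  · exact ⟨a, ha, b, ⟨trivial, hb⟩, h⟩
  · by_cases hc : c ∈ A
    · exact ⟨c, hc, b, ⟨trivial, hb⟩, h2⟩
    · exact ⟨a, ha, c, ⟨trivial, hc⟩, h1⟩

/-- A set that is traversed by a sequence with consecutive terms adjacent is cut-connected. -/
lemma CutConnected.of_seq (f : ℕ → V) (m : ℕ) (hf : ∀ i < m, G.Adj (f i) (f (i + 1)))
    (hS : ∀ z, z ∈ S ↔ ∃ i ≤ m, f i = z) : CutConnected G S := by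
  have key : ∀ k ≤ m, CutConnected G {z | ∃ i ≤ k, f i = z} := by
    intro k
    induction k with
    | zero =>
      intro _
      have : {z | ∃ i ≤ 0, f i = z} = {f 0} := by
        ext z; simp [eq_comm]
      rw [this]
      exact .singleton G _
    | succ k ih =>
      intro hk
      have := (ih (by omega)).insert (f := f (k + 1)) (s := f k) ⟨k, le_rfl, rfl⟩ (hf k (by omega))
      convert this using 1
      ext z
      constructor
      · rintro ⟨i, hi, rfl⟩
        rcases Nat.lt_or_ge k i with h | h
        · left; congr 1; omega
        · exact Or.inr ⟨i, h, rfl⟩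
      · rintro (rfl | ⟨i, hi, rfl⟩)
        · exact ⟨k + 1, le_rfl, rfl⟩
        · exact ⟨i, by omega, rfl⟩
  convert key m le_rfl using 1
  ext z
  exact hS z

/-- In a finite type, a point `x` of a set `D` lies in a component of `D`: a cut-connected subset
out of which no edge leads to the rest of `D`. -/
lemma exists_component [Finite V] {D : Set V} {x : V} (hx : x ∈ D) :
    ∃ X ⊆ D, x ∈ X ∧ CutConnected G X ∧ ∀ s ∈ X, ∀ f ∈ D, G.Adj s f → f ∈ X := by
  obtain ⟨X, -, hX⟩ := Finite.exists_le_maximal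
    (p := fun X : Set V => X ⊆ D ∧ x ∈ X ∧ CutConnected G X) (a := {x})
    ⟨by simpa using hx, rfl, .singleton G x⟩
  refine ⟨X, hX.prop.1, hX.prop.2.1, hX.prop.2.2, fun s hs f hf hsf => ?_⟩
  exact hX.le_of_ge ⟨Set.insert_subset hf hX.prop.1, Or.inr hX.prop.2.1,
    hX.prop.2.2.insert hs hsf⟩ (Set.subset_insert f X) (Set.mem_insert f X)

/-- Two points of a cut-connected set are joined by a walk in it, here a sequence of vertices. -/
lemma CutConnected.exists_seq (hS : CutConnected G S) {a b : V} (ha : a ∈ S)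
    (hb : b ∈ S) : ∃ (m : ℕ) (f : ℕ → V), f 0 = a ∧ f m = b ∧
      (∀ i ≤ m, f i ∈ S) ∧ ∀ i < m, G.Adj (f i) (f (i + 1)) := by
  by_contra hcon
  let A : Set V := {b | b ∈ S ∧ ∃ (m : ℕ) (f : ℕ → V), f 0 = a ∧ f m = b ∧
      (∀ i ≤ m, f i ∈ S) ∧ ∀ i < m, G.Adj (f i) (f (i + 1))}
  have haA : a ∈ A := ⟨ha, 0, fun _ => a, rfl, rfl, fun _ _ => ha, by simp⟩
  obtain ⟨c, ⟨hcS, m, f, h0, hm, hmem, hadj⟩, d, ⟨hdS, hdA⟩, hcd⟩ :=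
    hS A (fun z hz => hz.1) ⟨a, haA⟩ ⟨b, hb, fun h => hcon h.2⟩
  refine hdA ⟨hdS, m + 1, fun i => if i ≤ m then f i else d, by simpa using h0, by simp, ?_, ?_⟩
  · intro i _
    dsimp only
    split_ifs with h
    · exact hmem i h
    · exact hdS
  · intro i hi
    dsimp only
    rw [if_pos (by omega : i ≤ m)]
    split_ifs with h
    · exact hadj i (by omega)
    · obtain rfl : i = m := by omega
      rwa [hm]

end CutConnected

/-- A graph is *indecomposable* if it is none of `K₁`, a `0`-sum, a join, or a `1`-sum of smaller
graphs: it has at least two vertices, it and its complement are connected, and it stays connected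
when a vertex is removed. -/
structure IsIndecomposable {V : Type*} (G : SimpleGraph V) : Prop where
  nontrivial : Nontrivial V
  connected : CutConnected G Set.univ
  co_connected : CutConnected Gᶜ Set.univ
  connected_delete : ∀ v, CutConnected G {v}ᶜ

lemma IsIndecomposable.exists_two_adj {V : Type*} {G : SimpleGraph V} (hG : IsIndecomposable G)
    (w : V) : ∃ p q, p ≠ q ∧ G.Adj w p ∧ G.Adj w q := by
  have := hG.nontrivial
  obtain ⟨z, hz⟩ := exists_ne w
  obtain ⟨w', hw', p, ⟨-, hp⟩, hwp⟩ := hG.connected {w} (Set.subset_univ _) ⟨w, rfl⟩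
    ⟨z, trivial, hz⟩
  obtain rfl : w = w' := hw'.symm
  obtain ⟨w', hw', c, ⟨-, hc⟩, hwc⟩ := hG.co_connected {w} (Set.subset_univ _) ⟨w, rfl⟩
    ⟨z, trivial, hz⟩
  obtain rfl : w = w' := hw'.symm
  have hcp : c ≠ p := by
    rintro rfl
    exact ((compl_adj ..).1 hwc).2 hwp
  obtain ⟨w', hw', q, ⟨hq, -⟩, hwq⟩ := hG.connected_delete p {w}
    (by simpa using hwp.ne') ⟨w, rfl⟩ ⟨c, hcp, hc⟩
  obtain rfl : w = w' := hw'.symm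
  exact ⟨p, q, fun h => hq h.symm, hwp, hwq⟩

/-- The graphs of the theorem: the cycles of length at least five and the seven exceptional
graphs. -/
inductive IsObstruction : {n : ℕ} → SimpleGraph (Fin n) → Prop
  | cycle {n : ℕ} (hn : 5 ≤ n) : IsObstruction (cycleGraph n)
  | coP5 : IsObstruction coP5
  | domino : IsObstruction domino
  | graphH1 : IsObstruction graphH1
  | graphH2 : IsObstruction graphH2
  | graphH3 : IsObstruction graphH3
  | graphH4 : IsObstruction graphH4
  | graphH5 : IsObstruction graphH5

/-- No obstruction is isomorphic to an induced subgraph of `G`. -/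
def IsObstructionFree {V : Type*} (G : SimpleGraph V) : Prop :=
  ∀ (n : ℕ) (H : SimpleGraph (Fin n)), IsObstruction H → ¬ H ⊴ G

section Adjacency

lemma cycleGraph_adj_val {n : ℕ} (hn : 3 ≤ n) (i j : Fin n) :
    (cycleGraph n).Adj i j ↔ i.val + 1 = j.val ∨ j.val + 1 = i.val ∨
      (i.val = 0 ∧ j.val + 1 = n) ∨ (j.val = 0 ∧ i.val + 1 = n) := by
  rw [cycleGraph_adj']
  have hi := i.2
  have hj := j.2
  have h1 : (i - j).val = if j ≤ i then i.val - j.val else n + i.val - j.val := by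
    split_ifs with h
    · exact Fin.sub_val_of_le h
    · exact Fin.coe_sub_iff_lt.2 (not_le.1 h)
  have h2 : (j - i).val = if i ≤ j then j.val - i.val else n + j.val - i.val := by
    split_ifs with h
    · exact Fin.sub_val_of_le h
    · exact Fin.coe_sub_iff_lt.2 (not_le.1 h)
  rw [h1, h2]
  split_ifs with h3 h4 h4 <;> simp only [Fin.le_def] at h3 h4 <;> omega

instance : DecidableRel coP5.Adj := fun i j =>
  decidable_of_iff (i ≠ j ∧ ¬ (i.val + 1 = j.val ∨ j.val + 1 = i.val)) (by
    rw [coP5, compl_adj, pathGraph_adj])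

instance : DecidableRel domino.Adj := fun i j =>
  decidable_of_iff ((cycleGraph 6).Adj i j ∨ s(i, j) = s(1, 4) ∧ i ≠ j) (by
    simp [domino])

instance : DecidableRel graphH1.Adj := fun i j =>
  decidable_of_iff ((cycleGraph 6).Adj i j ∨ (s(i, j) = s(1, 4) ∨ s(i, j) = s(2, 4) ∨
    s(i, j) = s(2, 5) ∨ s(i, j) = s(1, 5)) ∧ i ≠ j) (by simp [graphH1])

instance : DecidableRel graphH2.Adj := fun i j =>
  decidable_of_iff ((cycleGraph 6).Adj i j ∨ (s(i, j) = s(1, 4) ∨ s(i, j) = s(2, 4) ∨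
    s(i, j) = s(2, 5)) ∧ i ≠ j) (by simp [graphH2])

instance : DecidableRel graphH3.Adj := fun i j =>
  decidable_of_iff ((cycleGraph 6).Adj i j ∨ (s(i, j) = s(1, 4) ∨ s(i, j) = s(2, 5)) ∧ i ≠ j)
    (by simp [graphH3])

instance : DecidableRel graphH4.Adj := fun i j =>
  decidable_of_iff ((cycleGraph 6).Adj i j ∨ (s(i, j) = s(1, 5) ∨ s(i, j) = s(1, 4) ∨
    s(i, j) = s(2, 4)) ∧ i ≠ j) (by simp [graphH4])

instance : DecidableRel graphH5.Adj := fun i j =>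
  decidable_of_iff ((cycleGraph 6).Adj i j ∨ (s(i, j) = s(1, 5) ∨ s(i, j) = s(3, 5) ∨
    s(i, j) = s(1, 3)) ∧ i ≠ j) (by simp [graphH5])

end Adjacency

/-! ### Small configurations -/

section Patterns

variable {V : Type*} {G : SimpleGraph V}

/-- It suffices to compare adjacency on the pairs `i < j`. -/
lemma isIndContained_of_fin {n : ℕ} (H : SimpleGraph (Fin n)) (f : Fin n → V)
    (h : ∀ i j, i < j → f i ≠ f j ∧ (G.Adj (f i) (f j) ↔ H.Adj i j)) : H ⊴ G := by
  refine ⟨⟨⟨f, fun i j hij => ?_⟩, fun {i j} => ?_⟩⟩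
  · rcases lt_trichotomy i j with hlt | heq | hlt
    · exact absurd hij (h i j hlt).1
    · exact heq
    · exact absurd hij.symm (h j i hlt).1
  · change G.Adj (f i) (f j) ↔ H.Adj i j
    rcases lt_trichotomy i j with hlt | rfl | hlt
    · exact (h i j hlt).2
    · simp
    · rw [G.adj_comm, H.adj_comm]
      exact (h j i hlt).2

/-- The house: a square `a b c d` with a vertex `e` on top of the edge `a b`. -/
lemma IsObstructionFree.not_house (hG : IsObstructionFree G) {a b c d e : V} (hab : G.Adj a b)
    (hbc : G.Adj b c) (hcd : G.Adj c d) (hda : G.Adj d a) (hea : G.Adj e a) (heb : G.Adj e b)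
    (hac : ¬ G.Adj a c) (hbd : ¬ G.Adj b d) (hec : ¬ G.Adj e c) (hed : ¬ G.Adj e d) : False := by
  have n1 : a ≠ c := by rintro rfl; exact hec hea
  have n2 : b ≠ d := by rintro rfl; exact hed heb
  have n3 : e ≠ c := by rintro rfl; exact hac hea.symm
  have n4 : e ≠ d := by rintro rfl; exact hbd heb.symm
  have := hab.ne; have := hbc.ne; have := hcd.ne; have := hda.ne; have := hea.ne; have := heb.ne
  refine hG 5 _ .coP5 (isIndContained_of_fin _ ![a, c, e, d, b] ?_)
  intro i j hij
  fin_cases i <;> fin_cases j <;> first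
    | exact absurd hij (by decide)
    | exact ⟨by first | assumption | exact Ne.symm (by assumption), iff_of_true
        (by first | assumption | exact G.adj_symm (by assumption)) (by decide)⟩
    | exact ⟨by first | assumption | exact Ne.symm (by assumption), iff_of_false
        (by first | assumption | exact fun h => absurd (G.adj_symm h) (by assumption)) (by decide)⟩

lemma IsObstructionFree.not_cycle_five (hG : IsObstructionFree G) {a b c d e : V}
    (hab : G.Adj a b) (hbc : G.Adj b c) (hcd : G.Adj c d) (hde : G.Adj d e) (hea : G.Adj e a)
    (hac : ¬ G.Adj a c) (had : ¬ G.Adj a d) (hbd : ¬ G.Adj b d) (hbe : ¬ G.Adj b e)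
    (hce : ¬ G.Adj c e) : False := by
  have n1 : a ≠ c := by rintro rfl; exact had hcd
  have n2 : a ≠ d := by rintro rfl; exact hac hcd.symm
  have n3 : b ≠ d := by rintro rfl; exact hbe hde
  have n4 : b ≠ e := by rintro rfl; exact hbd hde.symm
  have n5 : c ≠ e := by rintro rfl; exact hac hea.symm
  have := hab.ne; have := hbc.ne; have := hcd.ne; have := hde.ne; have := hea.ne
  refine hG 5 _ (.cycle le_rfl) (isIndContained_of_fin _ ![a, b, c, d, e] ?_)
  intro i j hij
  fin_cases i <;> fin_cases j <;> first
    | exact absurd hij (by decide)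
    | exact ⟨by first | assumption | exact Ne.symm (by assumption), iff_of_true
        (by first | assumption | exact G.adj_symm (by assumption)) (by decide)⟩
    | exact ⟨by assumption, iff_of_false (by assumption) (by decide)⟩

/-- The graph `H₅` is the `3`-sun: a triangle `p q r` with one further vertex on top of each
edge. -/
lemma IsObstructionFree.not_three_sun (hG : IsObstructionFree G) {p q r x y z : V}
    (hpq : G.Adj p q) (hqr : G.Adj q r) (hpr : G.Adj p r)
    (hxq : G.Adj x q) (hxr : G.Adj x r) (hxp : ¬ G.Adj x p)
    (hyp : G.Adj y p) (hyr : G.Adj y r) (hyq : ¬ G.Adj y q)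
    (hzp : G.Adj z p) (hzq : G.Adj z q) (hzr : ¬ G.Adj z r)
    (hxy : ¬ G.Adj x y) (hyz : ¬ G.Adj y z) (hxz : ¬ G.Adj x z) : False := by
  have n1 : x ≠ p := by rintro rfl; exact hxy hyp.symm
  have n2 : y ≠ q := by rintro rfl; exact hyz hzq.symm
  have n3 : z ≠ r := by rintro rfl; exact hxz hxr
  have n4 : x ≠ y := by rintro rfl; exact hyq hxq
  have n5 : y ≠ z := by rintro rfl; exact hzr hyr
  have n6 : x ≠ z := by rintro rfl; exact hzr hxr
  have := hpq.ne; have := hqr.ne; have := hpr.ne; have := hxq.ne; have := hxr.ne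
  have := hyp.ne; have := hyr.ne; have := hzp.ne; have := hzq.ne
  refine hG 6 _ .graphH5 (isIndContained_of_fin _ ![z, p, y, r, x, q] ?_)
  intro i j hij
  fin_cases i <;> fin_cases j <;> first
    | exact absurd hij (by decide)
    | exact ⟨by first | assumption | exact Ne.symm (by assumption), iff_of_true
        (by first | assumption | exact G.adj_symm (by assumption)) (by decide)⟩
    | exact ⟨by first | assumption | exact Ne.symm (by assumption), iff_of_false
        (by first | assumption | exact fun h => absurd (G.adj_symm h) (by assumption)) (by decide)⟩

/-- Two vertices `x` and `y` at distance three cannot be joined by two disjoint paths of length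
three: the six vertices span a hexagon in which only the four chords among `w₁, w₂, b₁, b₂` are
undetermined, and each of the sixteen possibilities contains an obstruction. -/
lemma IsObstructionFree.not_two_paths (hG : IsObstructionFree G) {x w₁ w₂ b₁ b₂ y : V}
    (hxw₁ : G.Adj x w₁) (hxw₂ : G.Adj x w₂) (hyb₁ : G.Adj y b₁) (hyb₂ : G.Adj y b₂)
    (h₁ : G.Adj w₁ b₁) (h₂ : G.Adj w₂ b₂) (hw : w₁ ≠ w₂) (hb : b₁ ≠ b₂) (hxy : ¬ G.Adj x y)
    (hxb₁ : ¬ G.Adj x b₁) (hxb₂ : ¬ G.Adj x b₂) (hyw₁ : ¬ G.Adj y w₁) (hyw₂ : ¬ G.Adj y w₂) :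
    False := by
  have n1 : x ≠ y := by rintro rfl; exact hxb₁ hyb₁
  have n2 : x ≠ b₁ := by rintro rfl; exact hxy hyb₁.symm
  have n3 : x ≠ b₂ := by rintro rfl; exact hxy hyb₂.symm
  have n4 : y ≠ w₁ := by rintro rfl; exact hxy hxw₁
  have n5 : y ≠ w₂ := by rintro rfl; exact hxy hxw₂
  have n6 : w₁ ≠ b₂ := by rintro rfl; exact hxb₂ hxw₁
  have n7 : w₂ ≠ b₁ := by rintro rfl; exact hxb₁ hxw₂
  have := hxw₁.ne; have := hxw₂.ne; have := hyb₁.ne; have := hyb₂.ne; have := h₁.ne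
  have := h₂.ne
  classical
  refine if hd₁ : G.Adj w₁ b₂ then
    if hd₂ : G.Adj w₂ b₁ then
      if hww : G.Adj w₁ w₂ then
        if hbb : G.Adj b₁ b₂ then
          hG 6 _ .graphH1 (isIndContained_of_fin _ ![x, w₁, b₁, y, b₂, w₂] ?_)
        else
          hG 6 _ .graphH2 (isIndContained_of_fin _ ![y, b₁, w₁, x, w₂, b₂] ?_)
      else
        if hbb : G.Adj b₁ b₂ then
          hG 6 _ .graphH2 (isIndContained_of_fin _ ![x, w₁, b₁, y, b₂, w₂] ?_)
        else
          hG 6 _ .graphH3 (isIndContained_of_fin _ ![x, w₁, b₁, y, b₂, w₂] ?_)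
    else
      if hww : G.Adj w₁ w₂ then
        if hbb : G.Adj b₁ b₂ then
          hG 6 _ .graphH4 (isIndContained_of_fin _ ![x, w₁, b₁, y, b₂, w₂] ?_)
        else
          hG 5 _ .coP5 (isIndContained_of_fin _ ![w₁, y, w₂, b₁, b₂] ?_)
      else
        if hbb : G.Adj b₁ b₂ then
          hG 5 _ .coP5 (isIndContained_of_fin _ ![w₁, w₂, b₁, x, b₂] ?_)
        else
          hG 6 _ .domino (isIndContained_of_fin _ ![x, w₁, b₁, y, b₂, w₂] ?_)
  else
    if hd₂ : G.Adj w₂ b₁ then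
      if hww : G.Adj w₁ w₂ then
        if hbb : G.Adj b₁ b₂ then
          hG 6 _ .graphH4 (isIndContained_of_fin _ ![x, w₂, b₂, y, b₁, w₁] ?_)
        else
          hG 5 _ .coP5 (isIndContained_of_fin _ ![w₂, y, w₁, b₂, b₁] ?_)
      else
        if hbb : G.Adj b₁ b₂ then
          hG 5 _ .coP5 (isIndContained_of_fin _ ![w₂, w₁, b₂, x, b₁] ?_)
        else
          hG 6 _ .domino (isIndContained_of_fin _ ![x, w₂, b₂, y, b₁, w₁] ?_)
    else
      if hww : G.Adj w₁ w₂ then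
        if hbb : G.Adj b₁ b₂ then
          hG 5 _ .coP5 (isIndContained_of_fin _ ![w₁, b₂, x, b₁, w₂] ?_)
        else
          hG 5 _ (.cycle le_rfl) (isIndContained_of_fin _ ![w₁, b₁, y, b₂, w₂] ?_)
      else
        if hbb : G.Adj b₁ b₂ then
          hG 5 _ (.cycle le_rfl) (isIndContained_of_fin _ ![b₁, w₁, x, w₂, b₂] ?_)
        else
          hG 6 _ (.cycle (by decide)) (isIndContained_of_fin _ ![x, w₁, b₁, y, b₂, w₂] ?_)
  all_goals
  intro i j hij
  fin_cases i <;> fin_cases j <;> first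
    | exact absurd hij (by decide)
    | exact ⟨by first | assumption | exact Ne.symm (by assumption), iff_of_true
        (by first | assumption | exact G.adj_symm (by assumption)) (by decide)⟩
    | exact ⟨by first | assumption | exact Ne.symm (by assumption), iff_of_false
        (by first | assumption | exact fun h => absurd (G.adj_symm h) (by assumption)) (by decide)⟩

end Patterns

/-! ### Closing shortest paths to long cycles -/

section Hole

variable {V : Type*} {G : SimpleGraph V}

/-- In a graph without long induced cycles, two nonadjacent neighbours `a` and `b` of `v` that both
have neighbours in a connected set `X` avoiding the closed neighbourhood of `v` have a common
neighbour in `X`: otherwise a shortest path from `a` to `b` through `X` closes up with `v` to an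
induced cycle of length at least five. -/
lemma IsObstructionFree.exists_common_of_not_adj (hG : IsObstructionFree G) {v a b : V} {X : Set V}
    (hva : G.Adj v a) (hvb : G.Adj v b) (hne : a ≠ b) (hab : ¬ G.Adj a b)
    (hX : CutConnected G X) (hvX : ∀ x ∈ X, x ≠ v ∧ ¬ G.Adj v x)
    (ha : ∃ x ∈ X, G.Adj a x) (hb : ∃ x ∈ X, G.Adj b x) :
    ∃ x ∈ X, G.Adj a x ∧ G.Adj b x := by
  classical
  obtain ⟨xa, hxa, haxa⟩ := ha
  obtain ⟨xb, hxb, hbxb⟩ := hb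
  have hS : CutConnected G (insert b (insert a X)) :=
    (hX.insert hxa haxa.symm).insert (Or.inr hxb) hbxb.symm
  have hex := hS.exists_seq (Or.inr (Or.inl rfl)) (Or.inl rfl)
  obtain ⟨f, h0, hm, hmem, hadj⟩ := Nat.find_spec hex
  have hmin := fun k (hk : k < Nat.find hex) => Nat.find_min hex hk
  generalize Nat.find hex = m at h0 hm hmem hadj hmin
  -- A shortest sequence has neither repetitions nor shortcuts.
  have hcut : ∀ i j, i < j → j ≤ m → f i ≠ f j := by
    intro i j hij hj heq
    refine hmin (m - (j - i)) (by omega)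
      ⟨fun k => if k ≤ i then f k else f (k + (j - i)), by simpa using h0, ?_, ?_, ?_⟩
    · dsimp only
      split_ifs with h
      · obtain rfl : j = m := by omega
        rw [show j - (j - i) = i by omega, heq, hm]
      · rw [show m - (j - i) + (j - i) = m by omega, hm]
    · intro k hk
      dsimp only
      split_ifs with h
      · exact hmem k (by omega)
      · exact hmem _ (by omega)
    · intro k hk
      dsimp only
      split_ifs with h1 h2 h2
      · exact hadj k (by omega)
      · obtain rfl : k = i := by omega
        rw [heq, show k + 1 + (j - k) = j + 1 by omega]
        exact hadj j (by omega)
      · omega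
      · rw [show k + 1 + (j - i) = k + (j - i) + 1 by omega]
        exact hadj _ (by omega)
  have hchord : ∀ i j, i + 1 < j → j ≤ m → ¬ G.Adj (f i) (f j) := by
    intro i j hij hj hadj'
    refine hmin (m - (j - i - 1)) (by omega)
      ⟨fun k => if k ≤ i then f k else f (k + (j - i - 1)), by simpa using h0, ?_, ?_, ?_⟩
    · dsimp only
      rw [if_neg (by omega), show m - (j - i - 1) + (j - i - 1) = m by omega, hm]
    · intro k hk
      dsimp only
      split_ifs with h
      · exact hmem k (by omega)
      · exact hmem _ (by omega)
    · intro k hk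
      dsimp only
      split_ifs with h1 h2 h2
      · exact hadj k (by omega)
      · obtain rfl : k = i := by omega
        rw [show k + 1 + (j - k - 1) = j by omega]
        exact hadj'
      · omega
      · rw [show k + 1 + (j - i - 1) = k + (j - i - 1) + 1 by omega]
        exact hadj _ (by omega)
  have hmX : ∀ i, 0 < i → i < m → f i ∈ X := by
    intro i hi him
    rcases hmem i him.le with h | h | h
    · exact absurd (h.trans hm.symm) (hcut i m him le_rfl)
    · exact absurd (h0.trans h.symm) (hcut 0 i hi him.le)
    · exact h
  have hm0 : m ≠ 0 := by rintro rfl; exact hne (h0.symm.trans hm)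
  have hm1 : m ≠ 1 := by
    rintro rfl
    have := hadj 0 one_pos
    rw [h0, hm] at this
    exact hab this
  by_cases hm2 : m = 2
  · subst hm2
    refine ⟨f 1, hmX 1 one_pos (by omega), h0 ▸ hadj 0 (by omega), ?_⟩
    rw [← hm]
    exact (hadj 1 (by omega)).symm
  · exfalso
    have hfv : ∀ i ≤ m, f i ≠ v ∧ (G.Adj (f i) v ↔ i = 0 ∨ i = m) := by
      intro i him
      rcases Nat.eq_zero_or_pos i with rfl | hi
      · rw [h0]
        exact ⟨hva.ne', by simp [hva.symm]⟩
      · rcases him.eq_or_lt with rfl | him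
        · rw [hm]
          exact ⟨hvb.ne', by simp [hvb.symm]⟩
        · refine ⟨(hvX _ (hmX i hi him)).1, iff_of_false ?_ (by omega)⟩
          exact fun h => (hvX _ (hmX i hi him)).2 h.symm
    refine hG (m + 2) _ (.cycle (by omega))
      (isIndContained_of_fin _ (fun i => if i.val ≤ m then f i else v) ?_)
    intro i j hij
    have hij' : i.val < j.val := hij
    have hj := j.2
    rw [cycleGraph_adj_val (by omega)]
    rw [if_pos (by omega : i.val ≤ m)]
    split_ifs with h
    · refine ⟨hcut _ _ hij' h, ?_⟩
      by_cases hs : i.val + 1 = j.val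
      · exact iff_of_true (hs ▸ hadj i (by omega)) (Or.inl hs)
      · exact iff_of_false (hchord _ _ (by omega) h) (by omega)
    · obtain ⟨h1, h2⟩ := hfv i (by omega)
      refine ⟨h1, h2.trans ?_⟩
      omega

end Hole

/-! ### Vertices at distance three -/

section FarApart

variable {V : Type*} {G : SimpleGraph V}

/-- The vertices at distance at least three from `y`. -/
def SimpleGraph.farFrom (G : SimpleGraph V) (y : V) : Set V :=
  {z | z ≠ y ∧ ¬ G.Adj y z ∧ ∀ b, G.Adj y b → ¬ G.Adj b z}

/-- If `X` is a connected set of vertices far from `y`, two neighbours `w₁`, `w₂` of `X` at distance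
two from `y` have a common neighbour in `X`. A shortest path from `w₁` to `w₂` through `X` that is
longer than two closes up, via `w₁ w₂` or via neighbours of `y`, to a long cycle, a house or a
domino. -/
lemma IsObstructionFree.exists_common_of_component [Finite V] (hG : IsObstructionFree G)
    {y w₁ w₂ b₁ b₂ : V} {X : Set V}
    (hX : CutConnected G X) (hXy : X ⊆ G.farFrom y) (hne : w₁ ≠ w₂)
    (hw₁ : w₁ ∉ X) (hw₂ : w₂ ∉ X) (hwy₁ : ¬ G.Adj y w₁) (hwy₂ : ¬ G.Adj y w₂)
    (hyb₁ : G.Adj y b₁) (hyb₂ : G.Adj y b₂) (h₁ : G.Adj b₁ w₁) (h₂ : G.Adj b₂ w₂)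
    (ha : ∃ x ∈ X, G.Adj w₁ x) (hb : ∃ x ∈ X, G.Adj w₂ x) :
    ∃ x ∈ X, G.Adj w₁ x ∧ G.Adj w₂ x := by
  have hy : ∀ x ∈ X, ∀ w, G.Adj w x → w ≠ y := by
    rintro x hx w hwx rfl
    exact (hXy hx).2.1 hwx
  have hbX : ∀ b, G.Adj y b → ∀ x ∈ X, x ≠ b ∧ ¬ G.Adj b x := by
    intro b hb x hx
    refine ⟨?_, (hXy hx).2.2 b hb⟩
    rintro rfl
    exact (hXy hx).2.1 hb
  by_cases hadj : G.Adj w₁ w₂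
  · by_contra hcon
    have hdisj : ∀ x ∈ X, G.Adj w₁ x → ¬ G.Adj w₂ x := fun x hx h h' => hcon ⟨x, hx, h, h'⟩
    obtain ⟨z, hzX, hwz⟩ := hb
    -- `w₁` sees a vertex `x₁` next to the component `Z` of `z` in `X \ N(w₁)`, and `x₁`, `w₂` have a
    -- common neighbour `x₂` in `Z`.
    obtain ⟨Z, hZD, hzZ, hZ, hZmax⟩ := exists_component (G := G)
      (D := {x | x ∈ X ∧ ¬ G.Adj w₁ x}) (x := z) ⟨hzX, fun h => hdisj z hzX h hwz⟩
    obtain ⟨x', hx'X, hx'⟩ := ha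
    obtain ⟨c, hc, x₁, ⟨hx₁X, hx₁Z⟩, hcx⟩ := hX Z (fun x hx => (hZD hx).1) ⟨z, hzZ⟩
      ⟨x', hx'X, fun h => (hZD h).2 hx'⟩
    have hwx₁ : G.Adj w₁ x₁ := by
      by_contra h
      exact hx₁Z (hZmax c hc x₁ ⟨hx₁X, h⟩ hcx)
    obtain ⟨x₂, hx₂Z, h21, h22⟩ := hG.exists_common_of_not_adj hadj hwx₁
      (by rintro rfl; exact hw₂ hx₁X) (hdisj x₁ hx₁X hwx₁) hZ
      (fun x hx => ⟨by rintro rfl; exact hw₁ (hZD hx).1, (hZD hx).2⟩) ⟨z, hzZ, hwz⟩ ⟨c, hc, hcx.symm⟩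
    have hx₂X := (hZD hx₂Z).1
    have hw₁x₂ : ¬ G.Adj w₁ x₂ := (hZD hx₂Z).2
    by_cases hcom : ∃ b, G.Adj y b ∧ G.Adj b w₁ ∧ G.Adj b w₂
    · obtain ⟨b, hyb, hbw₁, hbw₂⟩ := hcom
      exact hG.not_house hadj h21 h22.symm hwx₁.symm hbw₁ hbw₂ hw₁x₂ (hdisj x₁ hx₁X hwx₁)
        (hbX b hyb _ hx₂X).2 (hbX b hyb _ hx₁X).2
    · have hb₁w₂ : ¬ G.Adj b₁ w₂ := fun h => hcom ⟨b₁, hyb₁, h₁, h⟩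
      have hb₂w₁ : ¬ G.Adj b₂ w₁ := fun h => hcom ⟨b₂, hyb₂, h, h₂⟩
      by_cases hbb : G.Adj b₁ b₂
      · -- The squares `w₁ w₂ x₂ x₁` and `w₁ w₂ b₂ b₁` form a domino.
        exact hG.not_two_paths h21.symm h22.symm hbb h₁ h₂.symm hwx₁.symm
          (by rintro rfl; exact hw₂ hx₁X) (by rintro rfl; exact hwy₁ hyb₂)
          (fun h => (hbX _ hyb₁ _ hx₂X).2 h.symm) (fun h => (hbX _ hyb₂ _ hx₂X).2 h.symm)
          (fun h => hw₁x₂ h.symm) hb₁w₂ (hbX _ hyb₁ _ hx₁X).2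
      · exact hG.not_cycle_five h₁ hadj h₂.symm hyb₂.symm hyb₁ hb₁w₂ hbb (fun h => hb₂w₁ h.symm)
          (fun h => hwy₁ h.symm) (fun h => hwy₂ h.symm)
  · by_cases hcom : ∃ b, G.Adj y b ∧ G.Adj b w₁ ∧ G.Adj b w₂
    · obtain ⟨b, hyb, hbw₁, hbw₂⟩ := hcom
      exact hG.exists_common_of_not_adj hbw₁ hbw₂ hne hadj hX (hbX b hyb) ha hb
    · exfalso
      have hb₁w₂ : ¬ G.Adj b₁ w₂ := fun h => hcom ⟨b₁, hyb₁, h₁, h⟩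
      have hb₂w₁ : ¬ G.Adj b₂ w₁ := fun h => hcom ⟨b₂, hyb₂, h, h₂⟩
      obtain ⟨z, hzX, hwz⟩ := hb
      have hX₂ : CutConnected G (insert w₂ X) := hX.insert hzX hwz.symm
      have hX₂b : ∀ x ∈ insert w₂ X, x ≠ b₁ ∧ ¬ G.Adj b₁ x := by
        rintro x (rfl | hx)
        · exact ⟨by rintro rfl; exact hwy₂ hyb₁, hb₁w₂⟩
        · exact hbX b₁ hyb₁ x hx
      obtain ⟨x', hx'X, hx'⟩ := ha
      by_cases hbb : G.Adj b₁ b₂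
      · obtain ⟨x, hx, hx1, hx2⟩ := hG.exists_common_of_not_adj h₁ hbb
          (by rintro rfl; exact hwy₁ hyb₂) (fun h => hb₂w₁ h.symm) hX₂ hX₂b
          ⟨x', Or.inr hx'X, hx'⟩ ⟨w₂, Or.inl rfl, h₂⟩
        rcases hx with rfl | hx
        · exact hadj hx1
        · exact (hbX b₂ hyb₂ x hx).2 hx2
      · have hne' : b₂ ≠ b₁ := by rintro rfl; exact hb₁w₂ h₂
        obtain ⟨x, hx, hx1, hx2⟩ := hG.exists_common_of_not_adj (b := y)
          (X := insert b₂ (insert w₂ X)) h₁ hyb₁.symm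
          (hy _ hx'X _ hx') (fun h => hwy₁ h.symm) (hX₂.insert (Or.inl rfl) h₂.symm)
          (by
            rintro x (rfl | hx)
            · exact ⟨hne', hbb⟩
            · exact hX₂b x hx)
          ⟨x', Or.inr (Or.inr hx'X), hx'⟩ ⟨b₂, Or.inl rfl, hyb₂⟩
        rcases hx with rfl | rfl | hx
        · exact hb₂w₁ hx1.symm
        · exact hadj hx1
        · exact (hXy hx).2.1 hx2

/-- A component `X` of the vertices far from `y` has all its outside neighbours at distance two from
`y`. It has one that differs from any prescribed vertex `w`, since `w` does not separate `X` from
the rest of the graph. -/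
lemma IsIndecomposable.exists_two_boundary [Finite V] (hG : IsIndecomposable G) {x y : V}
    (hx : x ∈ G.farFrom y) : ∃ X ⊆ G.farFrom y, x ∈ X ∧ CutConnected G X ∧
      (∀ s ∈ X, ∀ w, G.Adj s w → w ∉ X → ¬ G.Adj y w ∧ ∃ b, G.Adj y b ∧ G.Adj b w) ∧
      ∀ w, (∃ z, z ≠ w ∧ z ∉ X) → ∃ w' ≠ w, w' ∉ X ∧ ∃ s ∈ X, G.Adj s w' := by
  obtain ⟨X, hXD, hxX, hX, hmax⟩ := exists_component (G := G) hx
  refine ⟨X, hXD, hxX, hX, fun s hs w hsw hw => ?_, fun w hw => ?_⟩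
  · have hyw : ¬ G.Adj y w := fun h => (hXD hs).2.2 w h hsw.symm
    refine ⟨hyw, ?_⟩
    by_contra hcon
    push Not at hcon
    refine hw (hmax s hs w ⟨?_, hyw, hcon⟩ hsw)
    rintro rfl
    exact (hXD hs).2.1 hsw.symm
  · by_cases hwX : w ∈ X
    · obtain ⟨z, hzw, hzX⟩ := hw
      obtain ⟨s, hs, w', ⟨-, hw'⟩, h⟩ := hG.connected X (Set.subset_univ _) ⟨x, hxX⟩
        ⟨z, trivial, hzX⟩
      exact ⟨w', by rintro rfl; exact hw' hwX, hw', s, hs, h⟩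
    · obtain ⟨z, hzw, hzX⟩ := hw
      obtain ⟨s, hs, w', ⟨hw'w, hw'⟩, h⟩ := hG.connected_delete w X
        (fun s hs => by rintro rfl; exact hwX hs) ⟨x, hxX⟩ ⟨z, hzw, hzX⟩
      exact ⟨w', hw'w, hw', s, hs, h⟩

/-- An obstruction-free indecomposable graph has diameter at most two. -/
lemma IsObstructionFree.farFrom_eq_empty [Finite V] (hG : IsObstructionFree G)
    (hI : IsIndecomposable G) (y : V) : G.farFrom y = ∅ := by
  rw [Set.eq_empty_iff_forall_notMem]
  intro x hx
  obtain ⟨X, hXy, -, hX, hbd, htwo⟩ := hI.exists_two_boundary hx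
  have hyX : y ∉ X := fun h => (hXy h).1 rfl
  obtain ⟨w₀, hw₀⟩ : ∃ w₀, G.Adj y w₀ := by
    obtain ⟨p, -, -, hp, -⟩ := hI.exists_two_adj y
    exact ⟨p, hp⟩
  have hw₀X : w₀ ∉ X := fun h => (hXy h).2.1 hw₀
  obtain ⟨w₁, -, hw₁X, s₁, hs₁, hsw₁⟩ := htwo w₀ ⟨y, hw₀.ne, hyX⟩
  obtain ⟨hyw₁, b₁, hyb₁, hbw₁⟩ := hbd s₁ hs₁ w₁ hsw₁ hw₁X
  obtain ⟨w₂, hne, hw₂X, s₂, hs₂, hsw₂⟩ := htwo w₁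
    ⟨y, by rintro rfl; exact (hXy hs₁).2.1 hsw₁.symm, hyX⟩
  obtain ⟨hyw₂, b₂, hyb₂, hbw₂⟩ := hbd s₂ hs₂ w₂ hsw₂ hw₂X
  obtain ⟨x₁, hx₁X, h₁, h₂⟩ := hG.exists_common_of_component hX hXy hne.symm hw₁X hw₂X hyw₁ hyw₂
    hyb₁ hyb₂ hbw₁ hbw₂ ⟨s₁, hs₁, hsw₁.symm⟩ ⟨s₂, hs₂, hsw₂.symm⟩
  obtain ⟨hxy, hyx, hxb⟩ := hXy hx₁X
  by_cases hcom : ∃ b, G.Adj y b ∧ G.Adj b w₁ ∧ G.Adj b w₂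
  · obtain ⟨b, hyb, hbw₁', hbw₂'⟩ := hcom
    -- Exchange the roles of `x₁` and `y`: now `b` has two neighbours adjacent to `x₁`, so that it
    -- and a second vertex of the boundary are matched to neighbours of `x₁`.
    have hyx₁ : y ∈ G.farFrom x₁ :=
      ⟨hxy.symm, fun h => hyx h.symm, fun c hc hcy => hxb c hcy.symm hc.symm⟩
    obtain ⟨Y, hYx, hyY, hY, hbdY, htwoY⟩ := hI.exists_two_boundary hyx₁
    have hbY : b ∉ Y := fun h => (hYx h).2.2 w₁ h₁.symm hbw₁'.symm
    have hx₁Y : x₁ ∉ Y := fun h => (hYx h).1 rfl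
    obtain ⟨b', hb'ne, hb'Y, s', hs', hsb'⟩ := htwoY b
      ⟨x₁, fun h => hyx (h ▸ hyb), hx₁Y⟩
    obtain ⟨hx₁b, -⟩ := hbdY y hyY b hyb hbY
    obtain ⟨hx₁b', w₃, hxw₃, hw₃b'⟩ := hbdY s' hs' b' hsb' hb'Y
    obtain ⟨y₁, hy₁Y, hby₁, hb'y₁⟩ := hG.exists_common_of_component hY hYx hb'ne.symm hbY hb'Y
      hx₁b hx₁b' h₁.symm hxw₃ hbw₁'.symm hw₃b' ⟨y, hyY, hyb.symm⟩ ⟨s', hs', hsb'.symm⟩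
    obtain ⟨-, hxy₁, hfar⟩ := hYx hy₁Y
    have key : ∀ w, G.Adj x₁ w → G.Adj b w → w ≠ w₃ → False := fun w hw hbw hwne =>
      hG.not_two_paths hw hxw₃ hby₁.symm hb'y₁.symm hbw.symm hw₃b' hwne hb'ne.symm hxy₁ hx₁b
        hx₁b' (fun h => hfar w hw h.symm) (fun h => hfar w₃ hxw₃ h.symm)
    by_cases hw : w₁ = w₃
    · exact key w₂ h₂.symm hbw₂' (fun h => hne (h.trans hw.symm))
    · exact key w₁ h₁.symm hbw₁' hw
  · exact hG.not_two_paths h₁.symm h₂.symm hyb₁ hyb₂ hbw₁.symm hbw₂.symm hne.symm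
      (by rintro rfl; exact hcom ⟨b₁, hyb₁, hbw₁, hbw₂⟩) (fun h => hyx h.symm)
      (fun h => hxb _ hyb₁ h.symm) (fun h => hxb _ hyb₂ h.symm) hyw₁ hyw₂

end FarApart

/-! ### Indecomposable graphs of diameter two -/

section DiameterTwo

variable {V : Type*} {G : SimpleGraph V}

/-- An obstruction-free graph of diameter at most two with at least two vertices is disconnected or
has a disconnected complement. The proof takes a maximal set `S` among those that have at least two
vertices, induce a connected subgraph of `Gᶜ`, and have a vertex `e` adjacent to all of `S`. -/
lemma IsObstructionFree.false_of_diam_two [Finite V] (hG : IsObstructionFree G)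
    (hI : IsIndecomposable G)
    (hdiam : ∀ a b, a ≠ b → ¬ G.Adj a b → ∃ c, G.Adj a c ∧ G.Adj c b) : False := by
  have co : ∀ {a b}, Gᶜ.Adj a b → ¬ G.Adj a b := fun h => ((compl_adj ..).1 h).2
  have := hI.nontrivial
  obtain ⟨p₀, z₀, hz₀⟩ := exists_pair_ne V
  obtain ⟨p, hp, q, ⟨-, hq⟩, hpq⟩ := hI.co_connected {p₀} (Set.subset_univ _) ⟨p₀, rfl⟩
    ⟨z₀, trivial, hz₀.symm⟩
  obtain ⟨e₀, hpe, heq⟩ := hdiam p q hpq.ne (co hpq)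
  obtain ⟨S, hle, hSmax⟩ := Finite.exists_le_maximal
    (p := fun S : Set V => CutConnected Gᶜ S ∧ ∃ e, ∀ s ∈ S, G.Adj e s)
    (a := insert q {p}) ⟨(CutConnected.singleton _ p).insert rfl hpq, e₀, by
      rintro s (rfl | rfl)
      · exact heq
      · exact hpe.symm⟩
  obtain ⟨⟨hS, e, he⟩, hmax⟩ := hSmax
  have hpS : p ∈ S := hle (Or.inr rfl)
  -- A vertex that is neither in `S` nor complete to `S` has no neighbour that is complete to `S`.
  have hEF : ∀ e', (∀ s ∈ S, G.Adj e' s) → ∀ f ∉ S, (∃ s ∈ S, ¬ G.Adj s f) → ¬ G.Adj e' f := by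
    intro e' he' f hf hsf hef
    obtain ⟨s, hs, hsf⟩ := hsf
    refine hf (hmax ⟨hS.insert hs ((compl_adj ..).2 ⟨by rintro rfl; exact hf hs, hsf⟩), e', ?_⟩
      (Set.subset_insert f S) (Set.mem_insert f S))
    rintro t (rfl | ht)
    · exact hef
    · exact he' t ht
  obtain ⟨f, t₀, hfS, ht₀, hft₀, u₀, hu₀, hfu₀⟩ :
      ∃ f t, f ∉ S ∧ t ∈ S ∧ G.Adj f t ∧ ∃ u ∈ S, ¬ G.Adj f u := by
    obtain ⟨e', he', f₁, ⟨-, hf₁⟩, hef₁⟩ := hI.co_connected {e' | ∀ s ∈ S, G.Adj e' s}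
      (Set.subset_univ _) ⟨e, he⟩ ⟨p, trivial, fun h => G.irrefl (h p hpS)⟩
    have hf₁S : f₁ ∉ S := fun h => co hef₁ (he' f₁ h)
    obtain ⟨f, ⟨hfS, hfE⟩, t, ⟨-, ht⟩, hft⟩ :=
      hI.connected {f | f ∉ S ∧ ¬ ∀ s ∈ S, G.Adj f s} (Set.subset_univ _) ⟨f₁, hf₁S, hf₁⟩
        ⟨p, trivial, fun h => h.1 hpS⟩
    have hfE' := hfE
    push Not at hfE
    obtain ⟨u, hu, hfu⟩ := hfE
    have htS : t ∈ S := by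
      by_contra htS
      have htE : ∀ s ∈ S, G.Adj t s := by
        by_contra h
        exact ht ⟨htS, h⟩
      exact hEF t htE f hfS ⟨u, hu, fun h => hfu h.symm⟩ hft.symm
    exact ⟨f, t, hfS, htS, hft, u, hu, hfu⟩
  have hef : ¬ G.Adj e f := hEF e he f hfS ⟨u₀, hu₀, fun h => hfu₀ h.symm⟩
  -- Nonadjacent neighbours of `f` in `S` have the same neighbours in `S \ N(f)`.
  have hsame : ∀ t₁ ∈ S, ∀ t₂ ∈ S, G.Adj f t₁ → G.Adj f t₂ → ¬ G.Adj t₁ t₂ → ∀ u ∈ S,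
      ¬ G.Adj f u → G.Adj u t₁ → G.Adj u t₂ := by
    intro t₁ ht₁ t₂ ht₂ h₁ h₂ hn u hu hfu hut₁
    by_contra hut₂
    exact hG.not_house (he t₁ ht₁).symm (he t₂ ht₂) h₂.symm h₁ hut₁ (he u hu).symm hn hef hut₂
      (fun h => hfu h.symm)
  -- Adjacent ones have comparable neighbourhoods there.
  have hnested : ∀ t₁ ∈ S, ∀ t₂ ∈ S, G.Adj f t₁ → G.Adj f t₂ → G.Adj t₁ t₂ → ∀ u₁ ∈ S, ∀ u₂ ∈ S,
      ¬ G.Adj f u₁ → ¬ G.Adj f u₂ → G.Adj t₁ u₁ → ¬ G.Adj t₁ u₂ → G.Adj t₂ u₂ → G.Adj t₂ u₁ := by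
    intro t₁ ht₁ t₂ ht₂ h₁ h₂ h₁₂ u₁ hu₁ u₂ hu₂ hf₁ hf₂ h11 h12 h22
    by_contra h21
    by_cases huu : G.Adj u₁ u₂
    · exact hG.not_house h₁₂ h22 huu.symm h11.symm h₁ h₂ h12 h21 hf₂ hf₁
    · exact hG.not_three_sun h₁₂ (he t₂ ht₂).symm (he t₁ ht₁).symm h22.symm (he u₂ hu₂).symm
        (fun h => h12 h.symm) h11.symm (he u₁ hu₁).symm (fun h => h21 h.symm) h₁ h₂
        (fun h => hef h.symm) (fun h => huu h.symm) (fun h => hf₁ h.symm) (fun h => hf₂ h.symm)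
  -- A neighbour of `f` in `S` that misses `u` is adjacent to another one that does not.
  have hext : ∀ t ∈ S, G.Adj f t → ∀ u ∈ S, ¬ G.Adj f u → ¬ G.Adj t u →
      ∃ g ∈ S, G.Adj f g ∧ G.Adj t g ∧ G.Adj g u := by
    intro t ht hft u hu hfu htu
    obtain ⟨g, hfg, hgu⟩ := hdiam f u (by rintro rfl; exact hfS hu) hfu
    have hge : G.Adj g e := by
      by_contra hge
      by_cases hgt : G.Adj g t
      · exact hG.not_house hgt (he t ht).symm (he u hu) hgu.symm hfg hft hge htu
          (fun h => hef h.symm) hfu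
      · exact hG.not_cycle_five hft (he t ht).symm (he u hu) hgu.symm hfg.symm (fun h => hef h.symm)
          hfu htu (fun h => hgt h.symm) (fun h => hge h.symm)
    have hgt : G.Adj g t := by
      by_contra hgt
      exact hG.not_house hge (he t ht) hft.symm hfg hgu.symm (he u hu).symm hgt hef
        (fun h => htu h.symm) (fun h => hfu h.symm)
    have hgS : g ∈ S := by
      by_contra hgS
      by_cases hgE : ∀ s ∈ S, G.Adj g s
      · exact hEF g hgE f hfS ⟨u, hu, fun h => hfu h.symm⟩ hfg.symm
      · push Not at hgE
        obtain ⟨s, hs, hgs⟩ := hgE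
        exact hEF e he g hgS ⟨s, hs, fun h => hgs h.symm⟩ hge.symm
    exact ⟨g, hgS, hfg, hgt.symm, hgu⟩
  -- Hence some neighbour of `f` in `S` is complete to `S \ N(f)`.
  obtain ⟨N, -, hN⟩ := Finite.exists_le_maximal
    (p := fun N : Set V => ∃ t ∈ S, G.Adj f t ∧ N = {u | u ∈ S ∧ ¬ G.Adj f u ∧ G.Adj t u})
    ⟨t₀, ht₀, hft₀, rfl⟩
  obtain ⟨t, ht, hft, rfl⟩ := hN.prop
  have htU : ∀ u ∈ S, ¬ G.Adj f u → G.Adj t u := by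
    intro u hu hfu
    by_contra htu
    obtain ⟨g, hg, hfg, htg, hgu⟩ := hext t ht hft u hu hfu htu
    have hsub := hN.le_of_ge ⟨g, hg, hfg, rfl⟩ (fun v hv => ⟨hv.1, hv.2.1,
      hnested t ht g hg hft hfg htg v hv.1 u hu hv.2.1 hfu hv.2.2 htu hgu⟩)
    exact htu (hsub ⟨hu, hfu, hgu⟩).2.2
  -- The set of all such vertices is complete to the rest of `S`.
  obtain ⟨z, ⟨hzS, hfz, hz⟩, b, ⟨hbS, hb⟩, hzb⟩ :=
    hS {t | t ∈ S ∧ G.Adj f t ∧ ∀ u ∈ S, ¬ G.Adj f u → G.Adj t u} (fun z hz => hz.1)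
      ⟨t, ht, hft, htU⟩ ⟨u₀, hu₀, fun h => hfu₀ h.2.1⟩
  by_cases hfb : G.Adj f b
  · exact hb ⟨hbS, hfb, fun u hu hfu => (hsame z hzS b hbS hfz hfb (co hzb) u hu hfu
      (hz u hu hfu).symm).symm⟩
  · exact co hzb (hz b hbS hfb)

/-- Every finite indecomposable graph contains an obstruction. -/
theorem IsIndecomposable.not_isObstructionFree [Finite V] (hI : IsIndecomposable G) :
    ¬ IsObstructionFree G := by
  intro hG
  refine hG.false_of_diam_two hI fun a b hne hab => ?_
  by_contra hcon
  push Not at hcon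
  have : b ∈ G.farFrom a := ⟨hne.symm, hab, hcon⟩
  rw [hG.farFrom_eq_empty hI a] at this
  exact this

end DiameterTwo

/-! ### Sesquicographs and decompositions -/

section Decomposition

variable {V : Type u} {G : SimpleGraph V}

/-- No indecomposable graph is an induced subgraph of a sesquicograph. The induction is on the
generation of the sesquicograph: an indecomposable induced subgraph of a `0`-sum, join or `1`-sum
lies in one of the two parts. -/
theorem IsSesquicograph.not_isIndContained (hG : IsSesquicograph G) {W : Type*} {H : SimpleGraph W}
    (hH : IsIndecomposable H) : ¬ H ⊴ G := by
  induction hG with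
  | single =>
    rintro ⟨f⟩
    have := hH.nontrivial
    obtain ⟨a, b, hab⟩ := exists_pair_ne W
    exact hab (f.injective (Subsingleton.elim _ _))
  | iso e _ ih =>
    intro h
    exact ih (h.trans ⟨e.symm.toEmbedding⟩)
  | @join V₁ V₂ G₁ G₂ _ _ ih₁ ih₂ =>
    rintro ⟨f⟩
    by_cases h₁ : ∃ a, (f a).isLeft
    · by_cases h₂ : ∃ b, (f b).isRight
      · obtain ⟨a, ha⟩ := h₁
        obtain ⟨b, hb⟩ := h₂
        obtain ⟨c, hc, d, ⟨-, hd⟩, hcd⟩ := hH.co_connected {a | (f a).isLeft} (Set.subset_univ _)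
          ⟨a, ha⟩ ⟨b, trivial, by simpa using hb⟩
        refine ((compl_adj ..).1 hcd).2 (f.map_adj_iff.1 (Or.inr (Or.inl ⟨hc, ?_⟩)))
        simpa using hd
      · have hl : ∀ b, ∃ x, f b = Sum.inl x := by
          intro b
          rcases h : f b with x | x
          · exact ⟨x, rfl⟩
          · exact absurd ⟨b, by simp [h]⟩ h₂
        choose g hg using hl
        refine ih₁ ⟨⟨⟨g, fun a b hab => f.injective (by rw [hg, hg, hab])⟩, fun {a b} => ?_⟩⟩
        change G₁.Adj (g a) (g b) ↔ _
        rw [← f.map_adj_iff, hg, hg]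
        simp [graphJoin]
    · have hr : ∀ b, ∃ x, f b = Sum.inr x := by
        intro b
        rcases h : f b with x | x
        · exact absurd ⟨b, by simp [h]⟩ h₁
        · exact ⟨x, rfl⟩
      choose g hg using hr
      refine ih₂ ⟨⟨⟨g, fun a b hab => f.injective (by rw [hg, hg, hab])⟩, fun {a b} => ?_⟩⟩
      change G₂.Adj (g a) (g b) ↔ _
      rw [← f.map_adj_iff, hg, hg]
      simp [graphJoin]
  | @zeroSum V₁ V₂ G₁ G₂ _ _ ih₁ ih₂ =>
    rintro ⟨f⟩
    by_cases h₁ : ∃ a, (f a).isLeft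
    · by_cases h₂ : ∃ b, (f b).isRight
      · obtain ⟨a, ha⟩ := h₁
        obtain ⟨b, hb⟩ := h₂
        obtain ⟨c, hc, d, ⟨-, hd⟩, hcd⟩ := hH.connected {a | (f a).isLeft} (Set.subset_univ _)
          ⟨a, ha⟩ ⟨b, trivial, by simpa using hb⟩
        rw [← f.map_adj_iff] at hcd
        rcases hc' : f c with x | x <;> rcases hd' : f d with y | y <;> simp_all
      · have hl : ∀ b, ∃ x, f b = Sum.inl x := by
          intro b
          rcases h : f b with x | x
          · exact ⟨x, rfl⟩
          · exact absurd ⟨b, by simp [h]⟩ h₂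
        choose g hg using hl
        refine ih₁ ⟨⟨⟨g, fun a b hab => f.injective (by rw [hg, hg, hab])⟩, fun {a b} => ?_⟩⟩
        change G₁.Adj (g a) (g b) ↔ _
        rw [← f.map_adj_iff, hg, hg]
        simp
    · have hr : ∀ b, ∃ x, f b = Sum.inr x := by
        intro b
        rcases h : f b with x | x
        · exact absurd ⟨b, by simp [h]⟩ h₁
        · exact ⟨x, rfl⟩
      choose g hg using hr
      refine ih₂ ⟨⟨⟨g, fun a b hab => f.injective (by rw [hg, hg, hab])⟩, fun {a b} => ?_⟩⟩
      change G₂.Adj (g a) (g b) ↔ _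
      rw [← f.map_adj_iff, hg, hg]
      simp
  | @oneSum V₁ V₂ G₁ G₂ a₀ b₀ _ _ ih₁ ih₂ =>
    classical
    rintro ⟨f⟩
    by_cases h₂ : ∃ b, (f b).isRight
    · by_cases h₁ : ∃ a x, f a = Sum.inl x ∧ x ≠ a₀
      · obtain ⟨a, x, ha, hx⟩ := h₁
        obtain ⟨b, hb⟩ := h₂
        -- The parts of `H` on the two sides are joined only through the identified vertex.
        have key : ∀ c d, (∃ x, f c = Sum.inl x ∧ x ≠ a₀) → f d ≠ Sum.inl a₀ →
            ¬ (∃ x, f d = Sum.inl x ∧ x ≠ a₀) → ¬ H.Adj c d := by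
          rintro c d ⟨x, hc, hx⟩ hd₀ hd hcd
          rw [← f.map_adj_iff, hc] at hcd
          rcases hd' : f d with y | y
          · exact hd ⟨y, hd', fun h => hd₀ (h ▸ hd')⟩
          · rw [hd'] at hcd
            exact hx hcd.1
        have hbL : ¬ ∃ x, f b = Sum.inl x ∧ x ≠ a₀ := by
          rintro ⟨x, hx, -⟩
          simp [hx] at hb
        by_cases hv : ∃ v, f v = Sum.inl a₀
        · obtain ⟨v, hv⟩ := hv
          obtain ⟨c, hc, d, ⟨hdv, hd⟩, hcd⟩ := hH.connected_delete v
            {c | ∃ x, f c = Sum.inl x ∧ x ≠ a₀}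
            (by
              rintro c ⟨x, hc, hx⟩ rfl
              exact hx (Sum.inl_injective (hc.symm.trans hv)))
            ⟨a, x, ha, hx⟩ ⟨b, by rintro rfl; simp [hv] at hb, hbL⟩
          exact key c d hc (fun h => hdv (f.injective (h.trans hv.symm))) hd hcd
        · obtain ⟨c, hc, d, ⟨-, hd⟩, hcd⟩ := hH.connected {c | ∃ x, f c = Sum.inl x ∧ x ≠ a₀}
            (Set.subset_univ _) ⟨a, x, ha, hx⟩ ⟨b, trivial, hbL⟩
          exact key c d hc (fun h => hv ⟨d, h⟩) hd hcd
      · push Not at h₁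
        have hr : ∀ b, ∃ x, (f b = Sum.inl a₀ ∧ x = b₀) ∨ ∃ h : x ≠ b₀, f b = Sum.inr ⟨x, h⟩ := by
          intro b
          rcases h : f b with x | x
          · exact ⟨b₀, Or.inl ⟨by rw [h₁ b x h], rfl⟩⟩
          · exact ⟨x.1, Or.inr ⟨x.2, rfl⟩⟩
        choose g hg using hr
        refine ih₂ ⟨⟨⟨g, fun a b hab => f.injective ?_⟩, fun {a b} => ?_⟩⟩
        · rcases hg a with ⟨ha, ha'⟩ | ⟨ha, ha'⟩ <;> rcases hg b with ⟨hb, hb'⟩ | ⟨hb, hb'⟩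
          · rw [ha, hb]
          · exact absurd (hab.symm.trans ha') hb
          · exact absurd (hab.trans hb') ha
          · rw [ha', hb']
            simp [hab]
        · change G₂.Adj (g a) (g b) ↔ _
          rw [← f.map_adj_iff]
          rcases hg a with ⟨ha, ha'⟩ | ⟨ha, ha'⟩ <;> rcases hg b with ⟨hb, hb'⟩ | ⟨hb, hb'⟩
          · simp [ha, hb, ha', hb']
          · rw [ha, hb', ha']
            simp [_root_.oneSum, oneSumAdj]
          · rw [ha', hb, hb']
            simp [_root_.oneSum, oneSumAdj, adj_comm]
          · rw [ha', hb']
            simp [_root_.oneSum, oneSumAdj]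
    · have hl : ∀ b, ∃ x, f b = Sum.inl x := by
        intro b
        rcases h : f b with x | x
        · exact ⟨x, rfl⟩
        · exact absurd ⟨b, by simp [h]⟩ h₂
      choose g hg using hl
      refine ih₁ ⟨⟨⟨g, fun a b hab => f.injective (by rw [hg, hg, hab])⟩, fun {a b} => ?_⟩⟩
      change G₁.Adj (g a) (g b) ↔ _
      rw [← f.map_adj_iff, hg, hg]
      simp [_root_.oneSum, oneSumAdj]

/-- A graph without edges between `A` and its complement is a `0`-sum. -/
lemma nonempty_sum_iso_of_cut (A : Set V) (h : ∀ a ∈ A, ∀ b ∉ A, ¬ G.Adj a b) :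
    Nonempty ((G.induce A ⊕g G.induce Aᶜ) ≃g G) := by
  classical
  refine ⟨⟨Equiv.Set.sumCompl A, fun {x y} => ?_⟩⟩
  rcases x with x | x <;> rcases y with y | y <;> simp
  · exact h _ x.2 _ y.2
  · exact fun h' => h _ y.2 _ x.2 h'.symm

/-- A graph with all edges between `A` and its complement is a join. -/
lemma nonempty_graphJoin_iso_of_cut (A : Set V) (h : ∀ a ∈ A, ∀ b ∉ A, G.Adj a b) :
    Nonempty (graphJoin (G.induce A) (G.induce Aᶜ) ≃g G) := by
  classical
  refine ⟨⟨Equiv.Set.sumCompl A, fun {x y} => ?_⟩⟩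
  rcases x with x | x <;> rcases y with y | y <;> simp [graphJoin]
  · exact h _ x.2 _ y.2
  · exact (h _ y.2 _ x.2).symm

/-- A graph in which `v` separates `A` from the remaining vertices is a `1`-sum. -/
lemma nonempty_oneSum_iso_of_cut (v : V) (A : Set V) (hv : v ∉ A)
    (h : ∀ a ∈ A, ∀ b ∉ A, b ≠ v → ¬ G.Adj a b) :
    Nonempty (oneSum (G.induce (insert v A)) ⟨v, Or.inl rfl⟩ (G.induce Aᶜ) ⟨v, hv⟩ ≃g G) := by
  classical
  refine ⟨⟨Equiv.ofBijective (Sum.elim (fun x => x.1) (fun x => x.1.1)) ⟨?_, ?_⟩, fun {x y} => ?_⟩⟩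
  · rintro (⟨x, hx⟩ | ⟨⟨x, hx⟩, hxv⟩) (⟨y, hy⟩ | ⟨⟨y, hy⟩, hyv⟩) hxy <;>
      simp only [Sum.elim_inl, Sum.elim_inr] at hxy <;> subst hxy
    · rfl
    · rcases hx with rfl | hx
      · exact absurd rfl hyv
      · exact absurd hx hy
    · rcases hy with rfl | hy
      · exact absurd rfl hxv
      · exact absurd hy hx
    · rfl
  · intro x
    by_cases hx : x ∈ insert v A
    · exact ⟨Sum.inl ⟨x, hx⟩, rfl⟩
    · exact ⟨Sum.inr ⟨⟨x, fun h => hx (Or.inr h)⟩, fun h => hx (Or.inl (congrArg Subtype.val h))⟩,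
        rfl⟩
  · have key : ∀ a ∈ insert v A, ∀ b ∉ A, b ≠ v → (G.Adj a b ↔ a = v ∧ G.Adj v b) := by
      rintro a (rfl | ha) b hb hbv
      · simp
      · exact iff_of_false (h a ha b hb hbv) fun h' => hv (h'.1 ▸ ha)
    rcases x with ⟨x, hx⟩ | ⟨⟨x, hx⟩, hxv⟩ <;> rcases y with ⟨y, hy⟩ | ⟨⟨y, hy⟩, hyv⟩
    · rfl
    · refine (key x hx y hy (fun h => hyv (Subtype.ext h))).trans ?_
      simp [oneSum, oneSumAdj, Subtype.ext_iff]
    · refine (G.adj_comm x y).trans ((key y hy x hx (fun h => hxv (Subtype.ext h))).trans ?_)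
      simp [oneSum, oneSumAdj, Subtype.ext_iff]
    · rfl

lemma IsObstructionFree.of_isIndContained {W : Type*} {H : SimpleGraph W}
    (hG : IsObstructionFree G) (h : H ⊴ G) : IsObstructionFree H :=
  fun n K hK hKH => hG n K hK (hKH.trans h)

/-- A finite obstruction-free graph is a sesquicograph: unless it has a single vertex it is not
indecomposable, and a cut that shows this expresses it by smaller induced subgraphs. -/
theorem IsObstructionFree.isSesquicograph [Finite V] [Nonempty V] (hG : IsObstructionFree G) :
    IsSesquicograph G := by
  induction hn : Nat.card V using Nat.strong_induction_on generalizing V with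
  | _ n ih =>
  subst hn
  have hind : ∀ s : Set V, s.Nonempty → sᶜ.Nonempty → IsSesquicograph (G.induce s) := by
    intro s hs hne
    have := hs.to_subtype
    exact ih _ (Set.ncard_lt_card (Set.nonempty_compl.1 hne))
      (hG.of_isIndContained ⟨Embedding.induce s⟩) rfl
  rcases subsingleton_or_nontrivial V with hV | hV
  · have e : PUnit.{u + 1} ≃ V := (Equiv.punitOfNonemptyOfSubsingleton).symm
    exact .iso ⟨e, by simp [Subsingleton.elim _ (e PUnit.unit)]⟩ .single
  · by_contra hcon
    refine IsIndecomposable.not_isObstructionFree ⟨hV, ?_, ?_, fun v => ?_⟩ hG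
    · rintro A - hA hA'
      rw [← Set.compl_eq_univ_sdiff] at hA' ⊢
      by_contra h
      push Not at h
      obtain ⟨e⟩ := nonempty_sum_iso_of_cut A h
      exact hcon (.iso e (.zeroSum (hind A hA hA') (hind Aᶜ hA' (by rwa [compl_compl]))))
    · rintro A - hA hA'
      rw [← Set.compl_eq_univ_sdiff] at hA' ⊢
      by_contra h
      push Not at h
      obtain ⟨e⟩ := nonempty_graphJoin_iso_of_cut (G := G) A (fun a ha b hb => by
        by_contra hab
        exact h a ha b hb ((compl_adj ..).2 ⟨fun h' => hb (h' ▸ ha), hab⟩))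
      exact hcon (.iso e (.join (hind A hA hA') (hind Aᶜ hA' (by rwa [compl_compl]))))
    · intro A hAv hA hA'
      by_contra h
      push Not at h
      obtain ⟨z, hzv, hzA⟩ := hA'
      have hvA : v ∉ A := fun h => hAv h rfl
      obtain ⟨e⟩ := nonempty_oneSum_iso_of_cut v A hvA (fun a ha b hb hbv => h a ha b ⟨hbv, hb⟩)
      refine hcon (.iso e (.oneSum _ _ (hind _ ⟨v, Or.inl rfl⟩ ⟨z, ?_⟩)
        (hind Aᶜ ⟨v, hvA⟩ (by rwa [compl_compl]))))
      rintro (h' | h')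
      · exact hzv h'
      · exact hzA h'

end Decomposition

/-! ### The obstructions are indecomposable and incomparable -/

section Obstructions

lemma CutConnected.of_finset {n : ℕ} {G : SimpleGraph (Fin n)} (T : Finset (Fin n))
    (h : ∀ A ⊆ T, A.Nonempty → (T \ A).Nonempty → ∃ a ∈ A, ∃ b ∈ T \ A, G.Adj a b) :
    CutConnected G (T : Set (Fin n)) := by
  classical
  intro A hA hne hne'
  have := h A.toFinset (by simpa [Set.toFinset_subset] using hA) (by simpa using hne)
    (by obtain ⟨z, hz⟩ := hne'; exact ⟨z, by simpa using hz⟩)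
  simpa using this

/-- Indecomposability of a graph on `Fin n` as a decidable condition. -/
lemma IsIndecomposable.of_finset {n : ℕ} [Nontrivial (Fin n)] {G : SimpleGraph (Fin n)}
    (h₁ : ∀ A ⊆ (Finset.univ : Finset (Fin n)), A.Nonempty → (Finset.univ \ A).Nonempty →
      ∃ a ∈ A, ∃ b ∈ Finset.univ \ A, G.Adj a b)
    (h₂ : ∀ A ⊆ (Finset.univ : Finset (Fin n)), A.Nonempty → (Finset.univ \ A).Nonempty →
      ∃ a ∈ A, ∃ b ∈ Finset.univ \ A, Gᶜ.Adj a b)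
    (h₃ : ∀ v, ∀ A ⊆ ({v}ᶜ : Finset (Fin n)), A.Nonempty → ({v}ᶜ \ A).Nonempty →
      ∃ a ∈ A, ∃ b ∈ {v}ᶜ \ A, G.Adj a b) : IsIndecomposable G where
  nontrivial := inferInstance
  connected := by simpa using CutConnected.of_finset _ h₁
  co_connected := by simpa using CutConnected.of_finset _ h₂
  connected_delete v := by simpa using CutConnected.of_finset _ (h₃ v)

lemma isIndecomposable_cycleGraph {n : ℕ} (hn : 5 ≤ n) : IsIndecomposable (cycleGraph n) where
  nontrivial := Fin.nontrivial_iff_two_le.2 (by omega)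
  connected := by
    refine .of_seq (fun i => ⟨i % n, Nat.mod_lt _ (by omega)⟩) (n - 1) ?_ ?_
    · intro i hi
      rw [cycleGraph_adj_val (by omega)]
      dsimp only
      rw [Nat.mod_eq_of_lt (by omega), Nat.mod_eq_of_lt (by omega)]
      omega
    · intro z
      have hz := z.2
      exact iff_of_true trivial ⟨z, by omega, Fin.ext (Nat.mod_eq_of_lt hz)⟩
  co_connected := by
    -- Nonadjacent vertices of the cycle are adjacent in the complement, and two consecutive ones
    -- both miss the vertex two steps further on.
    refine .of_forall_common fun a b hab => ?_
    have ha := a.2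
    have hb := b.2
    have hab' : a.val ≠ b.val := fun h => hab (Fin.ext h)
    by_cases h : (cycleGraph n).Adj a b
    · right
      rw [cycleGraph_adj_val (by omega)] at h
      obtain ⟨c, hc, hac, hbc, h⟩ : ∃ c < n, a.val ≠ c ∧ c ≠ b.val ∧
          ¬ (a.val + 1 = c ∨ c + 1 = a.val ∨ (a.val = 0 ∧ c + 1 = n) ∨ (c = 0 ∧ a.val + 1 = n)) ∧
          ¬ (c + 1 = b.val ∨ b.val + 1 = c ∨ (c = 0 ∧ b.val + 1 = n) ∨ (b.val = 0 ∧ c + 1 = n)) := by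
        by_cases h1 : a.val + 1 = b.val
        · by_cases h2 : a.val + 3 < n
          · exact ⟨a + 3, by omega, by omega, by omega, by omega, by omega⟩
          · exact ⟨a + 3 - n, by omega, by omega, by omega, by omega, by omega⟩
        by_cases h2 : b.val + 1 = a.val
        · by_cases h3 : b.val + 3 < n
          · exact ⟨b + 3, by omega, by omega, by omega, by omega, by omega⟩
          · exact ⟨b + 3 - n, by omega, by omega, by omega, by omega, by omega⟩
        · exact ⟨2, by omega, by omega, by omega, by omega, by omega⟩
      refine ⟨⟨c, hc⟩, ?_, ?_⟩ <;>
        rw [compl_adj, cycleGraph_adj_val (by omega)]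
      · exact ⟨fun h => hac (congrArg Fin.val h), h.1⟩
      · exact ⟨fun h => hbc (congrArg Fin.val h), h.2⟩
    · exact Or.inl ((compl_adj ..).2 ⟨hab, h⟩)
  connected_delete v := by
    have hv := v.2
    refine .of_seq (fun i => ⟨(v + 1 + i) % n, Nat.mod_lt _ (by omega)⟩) (n - 2) ?_ ?_
    · intro i hi
      rw [cycleGraph_adj_val (by omega)]
      dsimp only
      have h : ∀ k < 2 * n, k % n = if k < n then k else k - n := by
        intro k hk
        split_ifs with h
        · exact Nat.mod_eq_of_lt h
        · rw [Nat.mod_eq_sub_mod (by omega), Nat.mod_eq_of_lt (by omega)]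
      rw [h _ (by omega), h _ (by omega)]
      split_ifs <;> omega
    · intro z
      have hz := z.2
      rw [Set.mem_compl_iff, Set.mem_singleton_iff, Fin.ext_iff]
      constructor
      · intro hzv
        by_cases h : v.val < z.val
        · refine ⟨z - (v + 1), by omega, Fin.ext ?_⟩
          dsimp only
          rw [show v.val + 1 + (z.val - (v.val + 1)) = z.val by omega, Nat.mod_eq_of_lt hz]
        · refine ⟨z + n - (v + 1), by omega, Fin.ext ?_⟩
          dsimp only
          rw [show v.val + 1 + (z.val + n - (v.val + 1)) = z.val + n by omega, Nat.add_mod_right,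
            Nat.mod_eq_of_lt hz]
      · rintro ⟨i, hi, rfl⟩ h
        dsimp only at h
        by_cases h' : v.val + 1 + i < n
        · rw [Nat.mod_eq_of_lt h'] at h
          omega
        · rw [Nat.mod_eq_sub_mod (by omega), Nat.mod_eq_of_lt (by omega)] at h
          omega

set_option maxRecDepth 4000 in
lemma IsObstruction.isIndecomposable {n : ℕ} {H : SimpleGraph (Fin n)} (h : IsObstruction H) :
    IsIndecomposable H := by
  cases h with
  | cycle hn => exact isIndecomposable_cycleGraph hn
  | coP5 => exact .of_finset (by decide) (by decide) (by decide)
  | domino => exact .of_finset (by decide) (by decide) (by decide)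
  | graphH1 => exact .of_finset (by decide) (by decide) (by decide)
  | graphH2 => exact .of_finset (by decide) (by decide) (by decide)
  | graphH3 => exact .of_finset (by decide) (by decide) (by decide)
  | graphH4 => exact .of_finset (by decide) (by decide) (by decide)
  | graphH5 => exact .of_finset (by decide) (by decide) (by decide)

lemma IsObstruction.five_le {n : ℕ} {H : SimpleGraph (Fin n)} (h : IsObstruction H) : 5 ≤ n := by
  cases h <;> omega

/-- In an obstruction that is not a long cycle, the removal of any vertex `v` leaves two vertices,
possibly equal, that are adjacent to all remaining ones, or a vertex of degree at most one. -/
lemma IsObstruction.eq_cycleGraph_or_le_six {n : ℕ} {H : SimpleGraph (Fin n)}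
    (h : IsObstruction H) : H = cycleGraph n ∨ n ≤ 6 ∧ ∀ v, ∃ a ≠ v,
      (∃ b, b ≠ v ∧ ∀ c, c ≠ v → c ≠ a → c ≠ b → H.Adj a c ∧ H.Adj b c) ∨
      ∃ b, ∀ c, c ≠ v → H.Adj a c → c = b := by
  cases h with
  | cycle hn => exact Or.inl rfl
  | coP5 => exact Or.inr ⟨by decide, by decide⟩
  | domino => exact Or.inr ⟨by decide, by decide⟩
  | graphH1 => exact Or.inr ⟨by decide, by decide⟩
  | graphH2 => exact Or.inr ⟨by decide, by decide⟩
  | graphH3 => exact Or.inr ⟨by decide, by decide⟩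
  | graphH4 => exact Or.inr ⟨by decide, by decide⟩
  | graphH5 => exact Or.inr ⟨by decide, by decide⟩

/-- An embedding of one obstruction into another is surjective. Inside a cycle this holds because an
indecomposable graph has no vertex of degree at most one. The other obstructions have at most six
vertices, and removing a vertex `v` leaves either a vertex of degree at most one, or two vertices
`a`, `b` (possibly equal) that are adjacent to all remaining ones and thus disconnect the
complement. -/
lemma IsObstruction.surjective {m n : ℕ} {K : SimpleGraph (Fin m)} {H : SimpleGraph (Fin n)}
    (hK : IsObstruction K) (hH : IsObstruction H) (f : K ↪g H) : Function.Surjective f := by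
  have hKI := hK.isIndecomposable
  have hn := hH.five_le
  have hm := hK.five_le
  by_contra hsurj
  rw [Function.Surjective] at hsurj
  push Not at hsurj
  obtain ⟨v, hv⟩ := hsurj
  rcases hH.eq_cycleGraph_or_le_six with rfl | ⟨hn6, hdel⟩
  · obtain ⟨_, ⟨w, rfl⟩, b, ⟨-, hb⟩, hwb⟩ := hH.isIndecomposable.connected (Set.range f)
      (Set.subset_univ _) ⟨f ⟨0, by omega⟩, _, rfl⟩ ⟨v, trivial, fun ⟨x, hx⟩ => hv x hx⟩
    obtain ⟨p, q, hpq, hp, hq⟩ := hKI.exists_two_adj w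
    rw [← f.map_adj_iff, cycleGraph_adj_val (by omega)] at hp hq
    rw [cycleGraph_adj_val (by omega)] at hwb
    have h1 : (f p).val ≠ (f q).val := fun h => hpq (f.injective (Fin.ext h))
    have h2 : (f p).val ≠ b.val := fun h => hb ⟨p, Fin.ext h⟩
    have h3 : (f q).val ≠ b.val := fun h => hb ⟨q, Fin.ext h⟩
    have := (f w).2; have := (f p).2; have := (f q).2; have := b.2
    omega
  · have hrange : ∀ c, c ≠ v → ∃ x, f x = c := by
      intro c hc
      by_contra hcon
      have hsub : Finset.univ.map f.toEmbedding ⊆ ({v, c}ᶜ : Finset (Fin n)) := by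
        intro y hy
        obtain ⟨x, -, rfl⟩ := Finset.mem_map.1 hy
        simp only [Finset.mem_compl, Finset.mem_insert, Finset.mem_singleton, not_or]
        exact ⟨hv x, fun h => hcon ⟨x, h⟩⟩
      have := Finset.card_le_card hsub
      rw [Finset.card_map, Finset.card_compl, Finset.card_pair hc.symm] at this
      simp only [Finset.card_univ, Fintype.card_fin] at this
      omega
    obtain ⟨a, hav, ⟨b, hbv, hab⟩ | ⟨b, hb⟩⟩ := hdel v
    · obtain ⟨a, rfl⟩ := hrange a hav
      obtain ⟨b, rfl⟩ := hrange b hbv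
      obtain ⟨d, -, hd⟩ := Finset.exists_mem_notMem_of_card_lt_card
        (s := ({a, b} : Finset (Fin m))) (t := Finset.univ)
        (lt_of_le_of_lt Finset.card_le_two (by simp; omega))
      obtain ⟨s, hs, c, ⟨-, hc⟩, hsc⟩ := hKI.co_connected {a, b} (Set.subset_univ _)
        ⟨a, Or.inl rfl⟩ ⟨d, trivial, by simpa using hd⟩
      have hsc' := ((compl_adj ..).1 hsc).2
      rw [← f.map_adj_iff] at hsc'
      obtain ⟨h1, h2⟩ := hab (f c) (hv c) (fun h => hc (Or.inl (f.injective h)))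
        (fun h => hc (Or.inr (f.injective h)))
      rcases hs with rfl | rfl
      · exact hsc' h1
      · exact hsc' h2
    · obtain ⟨a, rfl⟩ := hrange a hav
      obtain ⟨p, q, hpq, hp, hq⟩ := hKI.exists_two_adj a
      rw [← f.map_adj_iff] at hp hq
      exact hpq (f.injective ((hb _ (hv p) hp).trans (hb _ (hv q) hq).symm))

end Obstructions

/-! ### Characterization and minimality -/

section Conclusion

variable {V : Type u} {G : SimpleGraph V}

lemma IsSesquicograph.isObstructionFree (hG : IsSesquicograph G) : IsObstructionFree G :=
  fun _ _ hH => hG.not_isIndContained hH.isIndecomposable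

lemma isSesquicograph_iff_isObstructionFree [Finite V] [Nonempty V] :
    IsSesquicograph G ↔ IsObstructionFree G :=
  ⟨IsSesquicograph.isObstructionFree, IsObstructionFree.isSesquicograph⟩

lemma isObstructionFree_iff : IsObstructionFree G ↔
    (∀ n : ℕ, 5 ≤ n → ¬ (cycleGraph n).IsIndContained G) ∧
      ¬ coP5.IsIndContained G ∧ ¬ domino.IsIndContained G ∧
      ¬ graphH1.IsIndContained G ∧ ¬ graphH2.IsIndContained G ∧ ¬ graphH3.IsIndContained G ∧
      ¬ graphH4.IsIndContained G ∧ ¬ graphH5.IsIndContained G := by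
  constructor
  · intro h
    exact ⟨fun n hn => h n _ (.cycle hn), h _ _ .coP5, h _ _ .domino, h _ _ .graphH1,
      h _ _ .graphH2, h _ _ .graphH3, h _ _ .graphH4, h _ _ .graphH5⟩
  · rintro ⟨h, h0, h1, h2, h3, h4, h5, h6⟩ n H hH
    cases hH with
    | cycle hn => exact h _ hn
    | _ => assumption

lemma exists_isObstruction_iso_iff :
    (∃ (n : ℕ) (H : SimpleGraph (Fin n)), IsObstruction H ∧ Nonempty (G ≃g H)) ↔
      (∃ n : ℕ, 5 ≤ n ∧ Nonempty (G ≃g cycleGraph n)) ∨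
      Nonempty (G ≃g coP5) ∨ Nonempty (G ≃g domino) ∨
      Nonempty (G ≃g graphH1) ∨ Nonempty (G ≃g graphH2) ∨ Nonempty (G ≃g graphH3) ∨
      Nonempty (G ≃g graphH4) ∨ Nonempty (G ≃g graphH5) := by
  constructor
  · rintro ⟨n, H, hH, he⟩
    cases hH with
    | cycle hn => exact Or.inl ⟨n, hn, he⟩
    | _ => simp only [he, true_or, or_true]
  · rintro (⟨n, hn, he⟩ | he | he | he | he | he | he | he)
    exacts [⟨_, _, .cycle hn, he⟩, ⟨_, _, .coP5, he⟩, ⟨_, _, .domino, he⟩, ⟨_, _, .graphH1, he⟩,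
      ⟨_, _, .graphH2, he⟩, ⟨_, _, .graphH3, he⟩, ⟨_, _, .graphH4, he⟩, ⟨_, _, .graphH5, he⟩]

lemma isMinimalNonSesquicograph_iff [Finite V] [Nonempty V] : IsMinimalNonSesquicograph G ↔
    ∃ (n : ℕ) (H : SimpleGraph (Fin n)), IsObstruction H ∧ Nonempty (G ≃g H) := by
  constructor
  · rintro ⟨hG, hmin⟩
    rw [isSesquicograph_iff_isObstructionFree, IsObstructionFree] at hG
    push Not at hG
    obtain ⟨n, H, hH, ⟨f⟩⟩ := hG
    have hn := hH.five_le
    have huniv : Set.range f = Set.univ := by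
      by_contra hne
      exact (hmin (Set.range f) ⟨f ⟨0, by omega⟩, _, rfl⟩ hne).isObstructionFree n H hH
        ⟨f.isoInduceRange.toEmbedding⟩
    exact ⟨n, H, hH, ⟨RelIso.symm (RelIso.ofSurjective f (Set.range_eq_univ.1 huniv))⟩⟩
  · rintro ⟨n, H, hH, ⟨e⟩⟩
    refine ⟨fun hG => hG.isObstructionFree n H hH ⟨e.symm.toEmbedding⟩, fun s hs hne => ?_⟩
    have := hs.to_subtype
    refine IsObstructionFree.isSesquicograph fun m K hK ⟨g⟩ => hne ?_
    have hsurj := hK.surjective hH ((e.toEmbedding.comp (Embedding.induce s)).comp g)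
    refine Set.eq_univ_of_forall fun x => ?_
    obtain ⟨k, hk⟩ := hsurj (e x)
    exact e.injective hk ▸ (g k).2

end Conclusion

theorem theorem1p2 {V : Type u} [Finite V] [Nonempty V] (G : SimpleGraph V) :
    (IsSesquicograph G ↔
      (∀ n : ℕ, 5 ≤ n → ¬ (cycleGraph n).IsIndContained G) ∧
      ¬ coP5.IsIndContained G ∧ ¬ domino.IsIndContained G ∧
      ¬ graphH1.IsIndContained G ∧ ¬ graphH2.IsIndContained G ∧ ¬ graphH3.IsIndContained G ∧
      ¬ graphH4.IsIndContained G ∧ ¬ graphH5.IsIndContained G) ∧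
    (IsMinimalNonSesquicograph G ↔
      (∃ n : ℕ, 5 ≤ n ∧ Nonempty (G ≃g cycleGraph n)) ∨
      Nonempty (G ≃g coP5) ∨ Nonempty (G ≃g domino) ∨
      Nonempty (G ≃g graphH1) ∨ Nonempty (G ≃g graphH2) ∨ Nonempty (G ≃g graphH3) ∨
      Nonempty (G ≃g graphH4) ∨ Nonempty (G ≃g graphH5)) :=
  ⟨isSesquicograph_iff_isObstructionFree.trans isObstructionFree_iff,
    isMinimalNonSesquicograph_iff.trans exists_isObstruction_iso_iff⟩
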